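/- Let $p\ge 1$ and $n\ge 1$ be integers. The Fibonacci $p$-numbers are defined by $F^p_0=0$, $F^p_i=1$ for $1\le i\le p$, and $F^p_m=F^p_{m-1}+F^p_{m-p-1}$ for $m\ge p+1$. A Fibonacci $p$-string of length $n$ is a binary string of length $n$ in which any two consecutive $1$s are separated by at least $p$ $0$s, and the Fibonacci $p$-cube $\Gamma_n^p$ is the subgraph induced by these strings in the hypercube $Q_n$ (whose vertices are the binary strings of length $n$, two of them being adjacent iff they differ in precisely one coordinate). For a finite connected graph $G$ with distance $d$, the Wiener index is $W(G)=\sum_{\{u,v\}\subset V(G)} d(u,v)$, the sum being over unordered pairs of distinct vertices, and the Mostar index is $\mathit{Mo}(G)=\sum_{uv\in E(G)}|n_{u,v}-n_{v,u}|$, where $n_{u,v}$ is the number of vertices closer to $u$ than to $v$. Then $\Gamma_n^p$ is connected, and $$W(\Gamma_n^p)=F^p_{n+p+1}\sum_{i=1}^n F^p_iF^p_{n-i+1}-\sum_{i=1}^n\bigl(F^p_iF^p_{n-i+1}\bigr)^2,$$ $$\mathit{Mo}(\Gamma_n^p)=F^p_{n+p+1}\sum_{i=1}^n F^p_iF^p_{n-i+1}-2\sum_{i=1}^n\bigl(F^p_iF^p_{n-i+1}\bigr)^2.$$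 -/

import Mathlib

/-- The hypercube of dimension `n`: the vertices are the binary strings of length `n`, and two
strings are adjacent iff they differ in precisely one coordinate. -/
def hypercubeGraph (n : ℕ) : SimpleGraph (Fin n → Bool) where
  Adj u v := hammingDist u v = 1
  symm := ⟨fun u v h => by rw [hammingDist_comm]; exact h⟩
  loopless := ⟨fun u h => by simp at h⟩

/-- The set of Fibonacci `p`-strings of length `n`: the binary strings in which any two `1`s are
separated by at least `p` `0`s, that is, any two `1`s, at positions `i < j`, satisfy
`j - i - 1 ≥ p`. -/
def fibStrings (p n : ℕ) : Set (Fin n → Bool) :=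
  {u | ∀ i j : Fin n, i < j → u i = true → u j = true → (i : ℕ) + p < (j : ℕ)}

/-- The Fibonacci `p`-cube: the subgraph of the hypercube of dimension `n` induced by the
Fibonacci `p`-strings of length `n`. -/
def fibCube (p n : ℕ) : SimpleGraph (fibStrings p n) :=
  (hypercubeGraph n).induce (fibStrings p n)

/-- The Fibonacci `p`-numbers (for `p ≥ 1`): `F 0 = 0`, `F i = 1` for `1 ≤ i ≤ p`, and
`F m = F (m - 1) + F (m - p - 1)` for `m ≥ p + 1`. -/
def fibP (p : ℕ) : ℕ → ℕ
  | 0 => 0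
  | m + 1 => if m + 1 ≤ p then 1 else fibP p m + fibP p (m - p)
termination_by m => m
decreasing_by all_goals omega

open Classical in
/-- The Wiener index of a finite (connected) graph: the sum of the distances `d(u, v)` over all
unordered pairs `{u, v}` of distinct vertices. -/
noncomputable def wienerIndex {V : Type*} [Fintype V] (G : SimpleGraph V) : ℕ :=
  ∑ e : Sym2 V with ¬ e.IsDiag, Sym2.lift ⟨fun u v => G.dist u v, fun _ _ => G.dist_comm⟩ e

open Classical in
/-- The number of vertices that are closer to `u` than to `v`. -/
noncomputable def numCloser {V : Type*} [Fintype V] (G : SimpleGraph V) (u v : V) : ℕ :=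
  Finset.card {w : V | G.dist w u < G.dist w v}

open Classical in
/-- The Mostar index of a finite (connected) graph: the sum over its edges `uv` of
`|n_{u,v} - n_{v,u}|`, with `n_{u,v}` the number of vertices closer to `u` than to `v`. -/
noncomputable def mostarIndex {V : Type*} [Fintype V] (G : SimpleGraph V) : ℤ :=
  ∑ e ∈ G.edgeFinset,
    Sym2.lift ⟨fun u v => |(numCloser G u v : ℤ) - (numCloser G v u : ℤ)|,
      fun _ _ => abs_sub_comm _ _⟩ e

noncomputable instance instFintypeFibStrings (p n : ℕ) : Fintype (fibStrings p n) :=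
  Fintype.ofFinite _

/-! Changing a `1` to `0` keeps a Fibonacci string Fibonacci. Hence two strings can be joined inside
the cube by erasing, at each disagreeing coordinate, the `1` on whichever side has it, so graph
distance is Hamming distance (`fibCube_dist`). Both indices then split over coordinates. Let N be
the number of vertices and Nᵢ the number with a `1` at i. Coordinate i separates Nᵢ(N - Nᵢ) pairs,
its share of the Wiener index. It also carries Nᵢ edges, each splitting the vertices according to
their i-th bit and so contributing N - 2Nᵢ ≥ 0 to the Mostar index. The counts are N = F_{n+p+1}
(`card_fibSets`) and, for the 0-based position i, Nᵢ = F_{i+1} F_{n-i} (`card_fibSets_filter_mem`).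
-/

/-! ### Counting Fibonacci strings as sets of natural numbers -/

/-- The subsets of `[a, b)` in which any two elements differ by more than `p`. -/
def fibSets (p a b : ℕ) : Finset (Finset ℕ) :=
  (Finset.Ico a b).powerset.filter fun S => ∀ i ∈ S, ∀ j ∈ S, i < j → i + p < j

theorem mem_fibSets {p a b : ℕ} {S : Finset ℕ} :
    S ∈ fibSets p a b ↔
      (∀ i ∈ S, a ≤ i ∧ i < b) ∧ ∀ i ∈ S, ∀ j ∈ S, i < j → i + p < j := by
  simp [fibSets, Finset.subset_iff]

/-- The value 1 persists one step past the defining range, since F_{p+1} = F_p + F_0. -/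
theorem fibP_of_pos_of_le {p m : ℕ} (h0 : 1 ≤ m) (h : m ≤ p + 1) (hp : 1 ≤ p) :
    fibP p m = 1 := by
  have small : ∀ k, 1 ≤ k → k ≤ p → fibP p k = 1 := by
    intro k h1 h2
    obtain ⟨k, rfl⟩ : ∃ l, k = l + 1 := ⟨k - 1, by omega⟩
    rw [fibP, if_pos h2]
  rcases Nat.lt_or_ge p m with h1 | h1
  · obtain rfl : m = p + 1 := by omega
    rw [fibP, if_neg (by omega), small p hp le_rfl, Nat.sub_self, fibP]
  · exact small m h0 h1

theorem fibP_add_succ (p m : ℕ) : fibP p (m + p + 1) = fibP p (m + p) + fibP p m := by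
  rw [fibP, if_neg (by omega), Nat.add_sub_cancel]

/-- Sets avoiding `a` lie in `[a+1, b)`; removing `a` from the others leaves a set in `[a+p+1, b)`.
This is the recursion of the p-numbers. An empty interval has one set, matching F_{p+1} = 1. -/
theorem card_fibSets {p : ℕ} (hp : 1 ≤ p) (a b : ℕ) :
    (fibSets p a b).card = fibP p (b - a + p + 1) := by
  induction hk : b - a using Nat.strong_induction_on generalizing a with
  | _ k ih =>
    subst hk
    rcases Nat.lt_or_ge a b with hab | hab
    · have split : fibSets p a b =
          fibSets p (a + 1) b ∪ (fibSets p (a + p + 1) b).image (insert a) := by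
        ext S
        simp only [Finset.mem_union, Finset.mem_image, mem_fibSets]
        constructor
        · rintro ⟨h1, h2⟩
          by_cases ha : a ∈ S
          · right
            refine ⟨S.erase a, ⟨fun i hi => ?_, fun i hi j hj => ?_⟩, Finset.insert_erase ha⟩
            · rw [Finset.mem_erase] at hi
              have := h1 i hi.2
              have := h2 a ha i hi.2 (by omega)
              omega
            · exact h2 i (Finset.mem_of_mem_erase hi) j (Finset.mem_of_mem_erase hj)
          · left
            refine ⟨fun i hi => ?_, h2⟩
            have := h1 i hi
            have : i ≠ a := fun h => ha (h ▸ hi)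
            omega
        · rintro (⟨h1, h2⟩ | ⟨T, ⟨h1, h2⟩, rfl⟩)
          · exact ⟨fun i hi => ⟨by have := h1 i hi; omega, (h1 i hi).2⟩, h2⟩
          · refine ⟨fun i hi => ?_, fun i hi j hj hij => ?_⟩
            · rcases Finset.mem_insert.1 hi with rfl | hi
              · omega
              · have := h1 i hi; omega
            · rcases Finset.mem_insert.1 hi with hi' | hi' <;>
                rcases Finset.mem_insert.1 hj with hj' | hj'
              · omega
              · have := h1 j hj'; omega
              · have := h1 i hi'; omega
              · exact h2 i hi' j hj' hij
      have disj : Disjoint (fibSets p (a + 1) b)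
          ((fibSets p (a + p + 1) b).image (insert a)) := by
        rw [Finset.disjoint_left]
        intro S h1 h2
        obtain ⟨T, -, rfl⟩ := Finset.mem_image.1 h2
        have := (mem_fibSets.1 h1).1 a (Finset.mem_insert_self a T)
        omega
      have notMem : ∀ T ∈ fibSets p (a + p + 1) b, a ∉ T := by
        intro T hT ha
        have := (mem_fibSets.1 hT).1 a ha
        omega
      have inj : Set.InjOn (insert a) (fibSets p (a + p + 1) b : Set (Finset ℕ)) := by
        intro S hS T hT h
        rw [← Finset.erase_insert (notMem S hS), ← Finset.erase_insert (notMem T hT)]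
        exact congrArg (fun U => Finset.erase U a) h
      rw [split, Finset.card_union_of_disjoint disj, Finset.card_image_of_injOn inj,
        ih _ (by omega) _ rfl, ih _ (by omega) _ rfl, fibP_add_succ p (b - a)]
      congr 1
      · congr 1; omega
      -- If the gap after `a` overruns `b`, the truncated length is 0, but both p-numbers are still
      -- 1.
      · rcases Nat.lt_or_ge b (a + p + 1) with h | h
        · rw [fibP_of_pos_of_le (by omega) (by omega) hp,
            fibP_of_pos_of_le (by omega) (by omega) hp]
        · congr 1; omega
    · have : fibSets p a b = {∅} := by
        ext S
        rw [Finset.mem_singleton, mem_fibSets]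
        constructor
        · rintro ⟨h, -⟩
          exact Finset.eq_empty_of_forall_notMem fun i hi => by have := h i hi; omega
        · rintro rfl
          simp
      rw [this, Finset.card_singleton, fibP_of_pos_of_le (by omega) (by omega) hp]

theorem fibP_sub_add {p k : ℕ} (hp : 1 ≤ p) : fibP p (k - p + p + 1) = fibP p (k + 1) := by
  rcases Nat.lt_or_ge k p with h | h
  · rw [fibP_of_pos_of_le (by omega) (by omega) hp, fibP_of_pos_of_le (by omega) (by omega) hp]
  · congr 1; omega

/-- An element `i` excludes all others within distance `p`, so the parts in `[0, i-p)` and `[i+p+1,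
n)` can be chosen independently. -/
theorem card_fibSets_filter_mem {p n i : ℕ} (hp : 1 ≤ p) (hi : i < n) :
    ((fibSets p 0 n).filter (i ∈ ·)).card = fibP p (i + 1) * fibP p (n - i) := by
  have e1 : (fibSets p 0 (i - p)).card = fibP p (i + 1) := by
    rw [card_fibSets hp, Nat.sub_zero, fibP_sub_add hp]
  have e2 : (fibSets p (i + p + 1) n).card = fibP p (n - i) := by
    rw [card_fibSets hp, show n - (i + p + 1) = (n - i - 1) - p by omega, fibP_sub_add hp,
      show n - i - 1 + 1 = n - i by omega]
  rw [← e1, ← e2, ← Finset.card_product]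
  refine Finset.card_bij' (fun S _ => (S.filter (· < i), S.filter (i < ·)))
    (fun T _ => insert i (T.1 ∪ T.2)) ?_ ?_ ?_ ?_
  · intro S hS
    obtain ⟨hS, hiS⟩ := Finset.mem_filter.1 hS
    obtain ⟨h1, h2⟩ := mem_fibSets.1 hS
    simp only [Finset.mem_product, mem_fibSets, Finset.mem_filter]
    refine ⟨⟨fun j hj => ?_, fun j hj k hk => h2 j hj.1 k hk.1⟩,
      ⟨fun j hj => ?_, fun j hj k hk => h2 j hj.1 k hk.1⟩⟩
    · have := h2 j hj.1 i hiS hj.2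
      omega
    · have := h2 i hiS j hj.1 hj.2
      have := h1 j hj.1
      omega
  · rintro ⟨A, B⟩ h
    obtain ⟨hA, hB⟩ := Finset.mem_product.1 h
    obtain ⟨a1, a2⟩ := mem_fibSets.1 hA
    obtain ⟨b1, b2⟩ := mem_fibSets.1 hB
    refine Finset.mem_filter.2 ⟨mem_fibSets.2 ⟨fun j hj => ?_, fun j hj k hk hjk => ?_⟩,
      Finset.mem_insert_self _ _⟩
    · simp only [Finset.mem_insert, Finset.mem_union] at hj
      rcases hj with rfl | hj | hj
      · omega
      · have := a1 j hj; omega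
      · have := b1 j hj; omega
    · simp only [Finset.mem_insert, Finset.mem_union] at hj hk
      rcases hj with rfl | hj | hj <;> rcases hk with rfl | hk | hk
      · omega
      · have := a1 k hk; omega
      · have := b1 k hk; omega
      · have := a1 j hj; omega
      · exact a2 j hj k hk hjk
      · have := a1 j hj; have := b1 k hk; omega
      · have := b1 j hj; omega
      · have := b1 j hj; have := a1 k hk; omega
      · exact b2 j hj k hk hjk
  · intro S hS
    have hiS := (Finset.mem_filter.1 hS).2
    ext j
    simp only [Finset.mem_insert, Finset.mem_union, Finset.mem_filter]
    constructor
    · rintro (rfl | h | h)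
      · exact hiS
      · exact h.1
      · exact h.1
    · intro h
      rcases lt_trichotomy j i with h' | h' | h'
      · exact Or.inr (Or.inl ⟨h, h'⟩)
      · exact Or.inl h'
      · exact Or.inr (Or.inr ⟨h, h'⟩)
  · rintro ⟨A, B⟩ h
    obtain ⟨hA, hB⟩ := Finset.mem_product.1 h
    obtain ⟨a1, -⟩ := mem_fibSets.1 hA
    obtain ⟨b1, -⟩ := mem_fibSets.1 hB
    ext j
    · simp only [Finset.mem_insert, Finset.mem_union, Finset.mem_filter]
      constructor
      · rintro ⟨rfl | h | h, h'⟩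
        · omega
        · exact h
        · have := b1 j h; omega
      · intro h
        have := a1 j h
        exact ⟨Or.inr (Or.inl h), by omega⟩
    · simp only [Finset.mem_insert, Finset.mem_union, Finset.mem_filter]
      constructor
      · rintro ⟨rfl | h | h, h'⟩
        · omega
        · have := a1 j h; omega
        · exact h
      · intro h
        have := b1 j h
        exact ⟨Or.inr (Or.inr h), by omega⟩

/-- The Fibonacci strings of length `n`, as sets of positions of their `1`s. -/
def fibStringsEquiv (p n : ℕ) : fibStrings p n ≃ fibSets p 0 n where
  toFun u := ⟨(Finset.univ.filter fun i => u.1 i = true).map Fin.valEmbedding, by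
    rw [mem_fibSets]
    simp only [Finset.mem_map, Finset.mem_filter, Finset.mem_univ, true_and, Fin.valEmbedding_apply]
    refine ⟨?_, ?_⟩
    · rintro _ ⟨i, -, rfl⟩
      exact ⟨Nat.zero_le _, i.2⟩
    · rintro _ ⟨i, hi, rfl⟩ _ ⟨j, hj, rfl⟩ hij
      exact u.2 i j hij hi hj⟩
  invFun S := ⟨fun i => decide ((i : ℕ) ∈ S.1), fun i j hij hi hj =>
    (mem_fibSets.1 S.2).2 i (of_decide_eq_true hi) j (of_decide_eq_true hj) hij⟩
  left_inv u := by
    ext i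
    simp [← Fin.ext_iff]
  right_inv S := by
    ext k
    simp only [Finset.mem_map, Finset.mem_filter, Finset.mem_univ, true_and,
      Fin.valEmbedding_apply, decide_eq_true_eq]
    exact ⟨by rintro ⟨i, hi, rfl⟩; exact hi,
      fun hk => ⟨⟨k, ((mem_fibSets.1 S.2).1 k hk).2⟩, hk, rfl⟩⟩

theorem mem_fibStringsEquiv {p n : ℕ} (u : fibStrings p n) (i : Fin n) :
    (i : ℕ) ∈ (fibStringsEquiv p n u).1 ↔ u.1 i = true := by
  simp [fibStringsEquiv, ← Fin.ext_iff]

theorem card_fibStrings {p : ℕ} (hp : 1 ≤ p) (n : ℕ) :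
    Fintype.card (fibStrings p n) = fibP p (n + p + 1) := by
  rw [Fintype.card_congr (fibStringsEquiv p n), Fintype.card_coe, card_fibSets hp, Nat.sub_zero]

theorem card_fibStrings_filter {p n : ℕ} (hp : 1 ≤ p) (i : Fin n) :
    (Finset.univ.filter fun u : fibStrings p n => u.1 i = true).card =
      fibP p (i + 1) * fibP p (n - i) := by
  rw [← card_fibSets_filter_mem hp i.2]
  refine Finset.card_bij (fun u _ => (fibStringsEquiv p n u).1) ?_ ?_ ?_
  · intro u hu
    rw [Finset.mem_filter] at hu ⊢
    exact ⟨(fibStringsEquiv p n u).2, (mem_fibStringsEquiv u i).2 hu.2⟩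
  · intro u _ v _ h
    exact (fibStringsEquiv p n).injective (Subtype.ext h)
  · intro S hS
    obtain ⟨hS, hi⟩ := Finset.mem_filter.1 hS
    refine ⟨(fibStringsEquiv p n).symm ⟨S, hS⟩, ?_, by simp⟩
    rw [Finset.mem_filter, ← mem_fibStringsEquiv]
    exact ⟨Finset.mem_univ _, by simpa using hi⟩

/-! ### Distances in the Fibonacci cube -/

/-- Replacing the entry of a Fibonacci string at position `i` by `0`. -/
def eraseBit {p n : ℕ} (u : fibStrings p n) (i : Fin n) : fibStrings p n :=
  ⟨Function.update u.1 i false, fun j k hjk hj hk => by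
    have h : ∀ l, Function.update u.1 i false l = true → u.1 l = true := by
      intro l hl
      rcases eq_or_ne l i with rfl | hli
      · simp at hl
      · rwa [Function.update_of_ne hli] at hl
    exact u.2 j k hjk (h j hj) (h k hk)⟩

theorem eraseBit_self {p n : ℕ} (u : fibStrings p n) (i : Fin n) :
    (eraseBit u i).1 i = false := by
  simp [eraseBit]

theorem eraseBit_of_ne {p n : ℕ} (u : fibStrings p n) {i j : Fin n} (h : j ≠ i) :
    (eraseBit u i).1 j = u.1 j := by
  simp [eraseBit, h]

theorem hammingDist_eq_sum {n : ℕ} (u v : Fin n → Bool) :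
    hammingDist u v = ∑ i, if u i ≠ v i then 1 else 0 := by
  rw [hammingDist, Finset.card_filter]

theorem hammingDist_eraseBit {p n : ℕ} (u v : fibStrings p n) {i : Fin n}
    (hu : u.1 i = true) (hv : v.1 i = false) :
    hammingDist u.1 v.1 = hammingDist (eraseBit u i).1 v.1 + 1 := by
  rw [hammingDist_eq_sum, hammingDist_eq_sum, ← Finset.add_sum_erase _ _ (Finset.mem_univ i),
    ← Finset.add_sum_erase _ _ (Finset.mem_univ i), eraseBit_self, hu, hv]
  rw [Finset.sum_congr rfl fun j hj => by
    rw [← eraseBit_of_ne u (Finset.ne_of_mem_erase hj)]]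
  simp [add_comm]

theorem fibCube_adj {p n : ℕ} (u v : fibStrings p n) :
    (fibCube p n).Adj u v ↔ hammingDist u.1 v.1 = 1 := Iff.rfl

theorem fibCube_adj_eraseBit {p n : ℕ} (u : fibStrings p n) {i : Fin n} (hu : u.1 i = true) :
    (fibCube p n).Adj u (eraseBit u i) := by
  rw [fibCube_adj, hammingDist_eraseBit u _ hu (eraseBit_self u i), hammingDist_self]

/-- Erasing a `1` at a disagreeing coordinate, in whichever string has it, lowers the Hamming
distance by one and stays in the cube. -/
theorem exists_walk_length_eq_hammingDist {p n : ℕ} (u v : fibStrings p n) :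
    ∃ w : (fibCube p n).Walk u v, w.length = hammingDist u.1 v.1 := by
  induction hk : hammingDist u.1 v.1 generalizing u v with
  | zero =>
    obtain rfl : u = v := Subtype.ext (eq_of_hammingDist_eq_zero hk)
    exact ⟨.nil, rfl⟩
  | succ k ih =>
    have hne : u.1 ≠ v.1 := fun h => by simp [h] at hk
    obtain ⟨i, hi⟩ := Function.ne_iff.1 hne
    cases hu : u.1 i
    · have hv : v.1 i = true := by simpa [hu] using hi.symm
      have := hammingDist_eraseBit v u hv hu
      rw [hammingDist_comm v.1, hammingDist_comm _ u.1] at this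
      obtain ⟨w, hw⟩ := ih u (eraseBit v i) (by omega)
      exact ⟨w.concat (fibCube_adj_eraseBit v hv).symm, by simp [hw]⟩
    · have hv : v.1 i = false := by simpa [hu] using hi.symm
      have := hammingDist_eraseBit u v hu hv
      obtain ⟨w, hw⟩ := ih (eraseBit u i) v (by omega)
      exact ⟨.cons (fibCube_adj_eraseBit u hu) w, by simp [hw]⟩

theorem hammingDist_le_length {p n : ℕ} {u v : fibStrings p n} (w : (fibCube p n).Walk u v) :
    hammingDist u.1 v.1 ≤ w.length := by
  induction w with
  | nil => simp
  | @cons u x v h w ih =>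
    have := hammingDist_triangle u.1 x.1 v.1
    rw [(fibCube_adj u x).1 h] at this
    rw [SimpleGraph.Walk.length_cons]
    omega

theorem fibCube_connected (p n : ℕ) : (fibCube p n).Connected where
  preconnected u v := ⟨(exists_walk_length_eq_hammingDist u v).choose⟩
  nonempty := ⟨⟨fun _ => false, fun _ _ _ h => by simp at h⟩⟩

theorem fibCube_dist {p n : ℕ} (u v : fibStrings p n) :
    (fibCube p n).dist u v = hammingDist u.1 v.1 := by
  refine le_antisymm ?_ ?_
  · obtain ⟨w, hw⟩ := exists_walk_length_eq_hammingDist u v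
    exact hw ▸ SimpleGraph.dist_le w
  · obtain ⟨w, hw⟩ := (fibCube_connected p n).exists_walk_length_eq_dist u v
    exact hw ▸ hammingDist_le_length w

/-- The two endpoints differ only at `i`, so the i-th bit of `w` alone decides which is closer. -/
theorem dist_lt_dist_eraseBit_iff {p n : ℕ} (u w : fibStrings p n) {i : Fin n}
    (hu : u.1 i = true) :
    (fibCube p n).dist w u < (fibCube p n).dist w (eraseBit u i) ↔ w.1 i = true := by
  simp only [fibCube_dist, hammingDist_comm w.1]
  cases hw : w.1 i
  · have := hammingDist_eraseBit u w hu hw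
    simp only [Bool.false_eq_true, iff_false]
    omega
  · have h1 : hammingDist (eraseBit u i).1 w.1 = hammingDist u.1 w.1 + 1 := by
      have e := eraseBit_self u i
      rw [hammingDist_eq_sum, hammingDist_eq_sum, ← Finset.add_sum_erase _ _ (Finset.mem_univ i),
        ← Finset.add_sum_erase _ _ (Finset.mem_univ i), e, hu, hw]
      rw [Finset.sum_congr rfl fun j hj => by
        rw [eraseBit_of_ne u (Finset.ne_of_mem_erase hj)]]
      simp [add_comm]
    simp only [iff_true]
    omega

theorem dist_eraseBit_lt_dist_iff {p n : ℕ} (u w : fibStrings p n) {i : Fin n}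
    (hu : u.1 i = true) :
    (fibCube p n).dist w (eraseBit u i) < (fibCube p n).dist w u ↔ ¬ w.1 i = true := by
  rw [← dist_lt_dist_eraseBit_iff u w hu, not_lt]
  refine ⟨le_of_lt, fun h => lt_of_le_of_ne h fun h' => ?_⟩
  cases hw : w.1 i
  · have := hammingDist_eraseBit u w hu hw
    simp only [fibCube_dist, hammingDist_comm w.1] at h'
    omega
  · exact absurd ((dist_lt_dist_eraseBit_iff u w hu).2 hw) (not_lt.2 h)

/-! ### The two indices -/

/-- The number of unordered pairs separated by a predicate. -/
theorem card_sym2_separated {V : Type*} [Fintype V] [DecidableEq V] (P : V → Prop)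
    [DecidablePred P] (S : Finset (Sym2 V)) (hS : ∀ u v, s(u, v) ∈ S ↔ ¬ (P u ↔ P v)) :
    S.card = (Finset.univ.filter P).card * (Fintype.card V - (Finset.univ.filter P).card) := by
  have hc : Fintype.card V - (Finset.univ.filter P).card
      = (Finset.univ.filter fun v => ¬ P v).card := by
    have := Finset.card_filter_add_card_filter_not (s := (Finset.univ : Finset V)) P
    rw [Finset.card_univ] at this
    omega
  rw [hc, ← Finset.card_product]
  symm
  refine Finset.card_bij (fun x _ => s(x.1, x.2)) ?_ ?_ ?_
  · rintro ⟨u, v⟩ h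
    simp only [Finset.mem_product, Finset.mem_filter, Finset.mem_univ, true_and] at h
    exact (hS u v).2 (by tauto)
  · rintro ⟨u, v⟩ h ⟨u', v'⟩ h' he
    simp only [Finset.mem_product, Finset.mem_filter, Finset.mem_univ, true_and] at h h'
    rcases Sym2.eq_iff.1 he with ⟨h1, h2⟩ | ⟨h1, h2⟩
    · exact Prod.ext h1 h2
    · dsimp only at h1 h2
      subst h1
      exact absurd h.1 h'.2
  · intro e
    induction e with
    | _ u v =>
      intro he
      have := (hS u v).1 he
      by_cases hu : P u
      · exact ⟨(u, v), by simp; tauto, rfl⟩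
      · exact ⟨(v, u), by simp; tauto, Sym2.eq_swap⟩

/-- Double counting: each distance is the number of coordinates separating the pair, and the two
sums are exchanged. -/
theorem wienerIndex_fibCube (p n : ℕ) :
    wienerIndex (fibCube p n) = ∑ i : Fin n,
      (Finset.univ.filter fun u : fibStrings p n => u.1 i = true).card *
        (Fintype.card (fibStrings p n) -
          (Finset.univ.filter fun u : fibStrings p n => u.1 i = true).card) := by
  classical
  let sep (i : Fin n) : Sym2 (fibStrings p n) → Prop :=
    Sym2.lift ⟨fun u v => u.1 i ≠ v.1 i, fun _ _ => propext ne_comm⟩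
  have hd : ∀ e : Sym2 (fibStrings p n),
      Sym2.lift ⟨fun u v => (fibCube p n).dist u v, fun _ _ => SimpleGraph.dist_comm⟩ e =
        ∑ i, if sep i e then 1 else 0 := by
    intro e
    induction e with
    | _ u v =>
      simp only [sep, Sym2.lift_mk, fibCube_dist, hammingDist_eq_sum]
      exact Finset.sum_congr rfl fun i _ => by congr
  rw [wienerIndex, Finset.sum_congr rfl fun e _ => hd e, Finset.sum_comm]
  refine Finset.sum_congr rfl fun i _ => ?_
  rw [← Finset.card_filter, card_sym2_separated (fun u : fibStrings p n => u.1 i = true)]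
  intro u v
  simp only [Finset.mem_filter, Finset.mem_univ, true_and, Sym2.mk_isDiag_iff, sep, Sym2.lift_mk]
  rw [← Bool.eq_iff_iff]
  exact ⟨fun h => h.2, fun h => ⟨fun h' => h (h' ▸ rfl), h⟩⟩

theorem exists_eraseBit_of_adj {p n : ℕ} {u v : fibStrings p n} (h : (fibCube p n).Adj u v) :
    ∃ i, (u.1 i = true ∧ v = eraseBit u i) ∨ (v.1 i = true ∧ u = eraseBit v i) := by
  have hne : u.1 ≠ v.1 := fun h' => h.ne (Subtype.ext h')
  obtain ⟨i, hi⟩ := Function.ne_iff.1 hne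
  refine ⟨i, ?_⟩
  rw [fibCube_adj] at h
  cases hu : u.1 i
  · have hv : v.1 i = true := by simpa [hu] using hi.symm
    have := hammingDist_eraseBit v u hv hu
    rw [hammingDist_comm v.1, h] at this
    exact Or.inr ⟨hv, (Subtype.ext (eq_of_hammingDist_eq_zero (by omega))).symm⟩
  · have hv : v.1 i = false := by simpa [hu] using hi.symm
    have := hammingDist_eraseBit u v hu hv
    exact Or.inl ⟨rfl, (Subtype.ext (eq_of_hammingDist_eq_zero (by omega))).symm⟩

/-- Erasing bit `i` injects the strings with `1` there into those with `0`. This fixes the sign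
inside the Mostar absolute value. -/
theorem two_mul_card_filter_le {p n : ℕ} (i : Fin n) :
    2 * (Finset.univ.filter fun u : fibStrings p n => u.1 i = true).card ≤
      Fintype.card (fibStrings p n) := by
  have h := Finset.card_filter_add_card_filter_not (s := (Finset.univ : Finset (fibStrings p n)))
    (fun u => u.1 i = true)
  have h' : (Finset.univ.filter fun u : fibStrings p n => u.1 i = true).card ≤
      (Finset.univ.filter fun u : fibStrings p n => ¬ u.1 i = true).card := by
    refine Finset.card_le_card_of_injOn (fun u => eraseBit u i) ?_ ?_
    · intro u _
      simp [eraseBit_self]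
    · intro u hu v hv huv
      simp only [Finset.coe_filter, Finset.mem_univ, true_and, Set.mem_ofPred_eq] at hu hv
      refine Subtype.ext (funext fun j => ?_)
      rcases eq_or_ne j i with rfl | hj
      · rw [hu, hv]
      · have := congrArg (fun w : fibStrings p n => w.1 j) huv
        simpa only [eraseBit_of_ne _ hj] using this
  rw [Finset.card_univ] at h
  omega

/-- Each edge is named uniquely by its coordinate `i` and its endpoint having `1` at `i`. -/
theorem mostarIndex_fibCube (p n : ℕ) :
    mostarIndex (fibCube p n) = ∑ i : Fin n,
      ((Finset.univ.filter fun u : fibStrings p n => u.1 i = true).card : ℤ) *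
        ((Fintype.card (fibStrings p n) : ℤ) -
          2 * (Finset.univ.filter fun u : fibStrings p n => u.1 i = true).card) := by
  classical
  have hsum : ∀ i : Fin n,
      ((Finset.univ.filter fun u : fibStrings p n => u.1 i = true).card : ℤ) *
        ((Fintype.card (fibStrings p n) : ℤ) -
          2 * (Finset.univ.filter fun u : fibStrings p n => u.1 i = true).card) =
      ∑ u : fibStrings p n with u.1 i = true, ((Fintype.card (fibStrings p n) : ℤ) -
          2 * (Finset.univ.filter fun u : fibStrings p n => u.1 i = true).card) := by
    intro i
    rw [Finset.sum_const, nsmul_eq_mul]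
  rw [Finset.sum_congr rfl fun i _ => hsum i, Finset.sum_sigma', mostarIndex]
  symm
  refine Finset.sum_bij (fun x _ => s(x.2, eraseBit x.2 x.1)) ?_ ?_ ?_ ?_
  · rintro ⟨i, u⟩ h
    simp only [Finset.mem_sigma, Finset.mem_filter, Finset.mem_univ, true_and] at h
    rw [SimpleGraph.mem_edgeFinset, SimpleGraph.mem_edgeSet]
    exact fibCube_adj_eraseBit u h
  · rintro ⟨i, u⟩ hu ⟨j, v⟩ hv h
    simp only [Finset.mem_sigma, Finset.mem_filter, Finset.mem_univ, true_and] at hu hv h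
    rcases Sym2.eq_iff.1 h with ⟨rfl, h2⟩ | ⟨h1, h2⟩
    · have : i = j := by
        by_contra hij
        have e := eraseBit_self u i
        rw [h2, eraseBit_of_ne u hij, hu] at e
        exact Bool.noConfusion e
      rw [this]
    -- With endpoints swapped, each string would arise from the other by erasing a `1`, which is
    -- impossible.
    · have e : v.1 i = false := by rw [← h2, eraseBit_self]
      rcases eq_or_ne i j with rfl | hij
      · rw [e] at hv
        exact Bool.noConfusion hv
      · rw [h1, eraseBit_of_ne v hij, e] at hu
        exact Bool.noConfusion hu
  · intro e
    induction e with
    | _ u v =>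
      intro h
      rw [SimpleGraph.mem_edgeFinset, SimpleGraph.mem_edgeSet] at h
      obtain ⟨i, ⟨hu, rfl⟩ | ⟨hv, rfl⟩⟩ := exists_eraseBit_of_adj h
      · exact ⟨⟨i, u⟩, by simpa using hu, rfl⟩
      · exact ⟨⟨i, v⟩, by simpa using hv, Sym2.eq_swap⟩
  · rintro ⟨i, u⟩ hu
    simp only [Finset.mem_sigma, Finset.mem_filter, Finset.mem_univ, true_and] at hu
    have h1 : numCloser (fibCube p n) u (eraseBit u i) =
        (Finset.univ.filter fun u : fibStrings p n => u.1 i = true).card := by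
      rw [numCloser]
      congr 1
      ext w
      simp [dist_lt_dist_eraseBit_iff u w hu]
    have h2 : numCloser (fibCube p n) (eraseBit u i) u =
        (Finset.univ.filter fun u : fibStrings p n => ¬ u.1 i = true).card := by
      rw [numCloser]
      congr 1
      ext w
      simp [dist_eraseBit_lt_dist_iff u w hu]
    have h3 := Finset.card_filter_add_card_filter_not
      (s := (Finset.univ : Finset (fibStrings p n))) (fun u => u.1 i = true)
    have h4 := two_mul_card_filter_le (p := p) i
    rw [Finset.card_univ] at h3
    rw [Sym2.lift_mk]
    dsimp only
    rw [h1, h2, abs_sub_comm, abs_of_nonneg (by omega)]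
    omega

/-- Passes from the 1-based positions of the formula to the 0-based ones of `Fin n`. -/
theorem sum_Icc_eq_sum_fin (n : ℕ) (f : ℕ → ℕ → ℤ) :
    ∑ i ∈ Finset.Icc 1 n, f i (n - i + 1) = ∑ i : Fin n, f (i + 1) (n - i) := by
  rw [Fin.sum_univ_eq_sum_range (fun i => f (i + 1) (n - i)), ← Finset.Ico_add_one_right_eq_Icc,
    Finset.sum_Ico_eq_sum_range, Nat.add_sub_cancel]
  refine Finset.sum_congr rfl fun i hi => ?_
  have := Finset.mem_range.1 hi
  rw [add_comm 1 i, show n - (i + 1) + 1 = n - i by omega]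

theorem mainTheorem3 (p n : ℕ) (hp : 1 ≤ p) (hn : 1 ≤ n) :
    (fibCube p n).Connected ∧
    (wienerIndex (fibCube p n) : ℤ) =
      (fibP p (n + p + 1) : ℤ) *
          ∑ i ∈ Finset.Icc 1 n, (fibP p i : ℤ) * (fibP p (n - i + 1) : ℤ)
        - ∑ i ∈ Finset.Icc 1 n, ((fibP p i : ℤ) * (fibP p (n - i + 1) : ℤ)) ^ 2 ∧
    mostarIndex (fibCube p n) =
      (fibP p (n + p + 1) : ℤ) *
          ∑ i ∈ Finset.Icc 1 n, (fibP p i : ℤ) * (fibP p (n - i + 1) : ℤ)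
        - 2 * ∑ i ∈ Finset.Icc 1 n, ((fibP p i : ℤ) * (fibP p (n - i + 1) : ℤ)) ^ 2 := by
  have hle (i : Fin n) := two_mul_card_filter_le (p := p) i
  simp only [card_fibStrings_filter hp, card_fibStrings hp] at hle
  refine ⟨fibCube_connected p n, ?_, ?_⟩
  · rw [wienerIndex_fibCube, sum_Icc_eq_sum_fin n fun a b => (fibP p a : ℤ) * fibP p b,
      sum_Icc_eq_sum_fin n fun a b => ((fibP p a : ℤ) * fibP p b) ^ 2, Finset.mul_sum,
      ← Finset.sum_sub_distrib, Nat.cast_sum]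
    refine Finset.sum_congr rfl fun i _ => ?_
    rw [card_fibStrings_filter hp, card_fibStrings hp, Nat.cast_mul,
      Nat.cast_sub (by have := hle i; omega)]
    push_cast
    ring
  · rw [mostarIndex_fibCube, sum_Icc_eq_sum_fin n fun a b => (fibP p a : ℤ) * fibP p b,
      sum_Icc_eq_sum_fin n fun a b => ((fibP p a : ℤ) * fibP p b) ^ 2, Finset.mul_sum,
      Finset.mul_sum, ← Finset.sum_sub_distrib]
    refine Finset.sum_congr rfl fun i _ => ?_
    rw [card_fibStrings_filter hp, card_fibStrings hp]
    push_cast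
    ring
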